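/- **Setting.** Let $\mathbb V$ be a finite set of real-valued time series observed at the integer times $t\in[t_0,t_{\max}]$; the micro-variables are $X_t$. A full-time DAG (FT-DAG) is an acyclic directed graph on the micro-variables in which $X_{t'}\to Y_t$ implies $t'\le t$. Its summary causal graph (SCG) has one node $S_X$ per series and an edge $S_X\to S_Y$ (self-loops and 2-cycles allowed) iff $X_{t'}\to Y_t$ for some $t'\le t$. A dynamic structural causal model with FT-DAG $\mathcal G$ consists of equations $Y_t:=f^{y_t}(Pa(Y_t,\mathcal G),L^{y_t})$ with noise terms $L^{y_t}$. Its assumptions are: 1. *Causal sufficiency*: the noise terms are mutually independent and each enters only one equation. 2. *Faithfulness*: every conditional independence of the observational distribution (between disjoint sets of micro-variables) is entailed by the causal Markov condition of $\mathcal G$. 3. *Stationarity*: edges of $\mathcal G$ are invariant under time shifts inside $[t_0,t_{\max}]$, and $f^{y_t}=f^{y_s}$ (with correspondingly lagged parents) whenever the time shift matches the parents of $Y_t$ and $Y_s$. An FT-DAG is compatible with an SCG $\mathcal G^s$ if it is shift-invariant in the sense of 3 and its SCG is $\mathcal G^s$. For an FT-DAG $\mathcal G$, the FT-MPDAG $\mathcal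 M$ using $\mathcal G^s$ is obtained from the set of all FT-DAGs that entail the same conditional independencies as $\mathcal G$ and are compatible with $\mathcal G^s$: it has the directed edge $u\to v$ if $u\to v$ in all members of this set, and the undirected edge $u-v$ if some member has $u\to v$ and some member has $v\to u$. (For a faithful model it is a function of the observational distribution and $\mathcal G^s$.) An FT-DAG is represented by $\mathcal M$ if it has the same skeleton and unshielded colliders as $\mathcal M$ and contains all directed edges of $\mathcal M$. The pair $\{S_X,S_Y\}$ is *s-identifiable* if for every model satisfying 1, 2, 3 whose FT-DAG is compatible with $\mathcal G^s$, and every $t$, the FT-MPDAG does not contain the undirected edge $X_t-Y_t$. The *controlled direct effect* (CDE) of $x$ on $y$ is given by the distribution $P(y\mid do(x),do(pa(y,\mathcal G)\setminus\{x\}))$, and by the difference of its means at two values $x_0,x_1$ of $x$ with the other parents of $y$ fixed. It is *identifiable from $\mathcal M$* if any two causally sufficient models whose FT-DAGs are represented by $\mathcal M$ and which have the same observational distribution have the same CDE of $x$ on $y$. As usual for conditional distributions, equality is required for intervention values in a set of full observational probability (in particular, at all intervention values of positive probability). **Proposition.** Let $\mathcal G^s$ be an SCG and $Y$ a series such that the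 pair $\{S_X,S_Y\}$ is s-identifiable for every neighbour $S_X\neq S_Y$ of $S_Y$ in $\mathcal G^s$. Consider a model satisfying causal sufficiency, faithfulness and stationarity whose FT-DAG $\mathcal G$ is compatible with $\mathcal G^s$, and let $\mathcal M$ be its FT-MPDAG using $\mathcal G^s$. Then for every $t$ and every micro-variable $X_{t-\gamma}\ne Y_t$ with $\gamma\ge 0$, the controlled direct effect $P(Y_t\mid do(x_{t-\gamma}),do(pa(Y_t,\mathcal G)\setminus\{x_{t-\gamma}\}))$ is identifiable from $\mathcal M$. -/

import Mathlib

open MeasureTheory ProbabilityTheory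

noncomputable section

namespace TimeSeries

/-- The micro-variables: `(X, t)` is the variable `X_t` of the series `X` at time
`t ∈ [t₀, tmax]`. -/
abbrev Vtx (V : Type*) (t₀ tmax : ℤ) : Type _ := V × Set.Icc t₀ tmax

variable {V : Type*} {t₀ tmax : ℤ}

/-! ### Full-time DAGs and summary causal graphs -/

/-- A full-time DAG: acyclic, and causes never come after their effects. -/
structure FTDAG (V : Type*) (t₀ tmax : ℤ) where
  Edge : Vtx V t₀ tmax → Vtx V t₀ tmax → Prop
  acyclic : ∀ v, ¬ Relation.TransGen Edge v v
  temporal : ∀ u v, Edge u v → u.2 ≤ v.2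

namespace FTDAG

/-- Parents. -/
def pa (G : FTDAG V t₀ tmax) (v : Vtx V t₀ tmax) : Set (Vtx V t₀ tmax) := {u | G.Edge u v}

/-- Descendants; the trivial path makes `v` a descendant of itself. -/
def de (G : FTDAG V t₀ tmax) (v : Vtx V t₀ tmax) : Set (Vtx V t₀ tmax) :=
  {u | Relation.ReflTransGen G.Edge v u}

/-- Non-descendants. -/
def nd (G : FTDAG V t₀ tmax) (v : Vtx V t₀ tmax) : Set (Vtx V t₀ tmax) := (G.de v)ᶜ

/-- Adjacency (the skeleton). -/
def Adj (G : FTDAG V t₀ tmax) (u v : Vtx V t₀ tmax) : Prop := G.Edge u v ∨ G.Edge v u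

/-- `a → c ← b` with distinct non-adjacent `a`, `b`. -/
def UnshieldedCollider (G : FTDAG V t₀ tmax) (a c b : Vtx V t₀ tmax) : Prop :=
  G.Edge a c ∧ G.Edge b c ∧ a ≠ b ∧ ¬ G.Adj a b

/-- Edges are invariant under time shifts, as long as one stays within the window. -/
def Stationary (G : FTDAG V t₀ tmax) : Prop :=
  ∀ (X Y : V) (t' t s' s : Set.Icc t₀ tmax), (t : ℤ) - t' = (s : ℤ) - s' →
    G.Edge (X, t') (Y, t) → G.Edge (X, s') (Y, s)

/-- The summary causal graph of a full-time DAG (self-loops and 2-cycles are allowed). -/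
def scg (G : FTDAG V t₀ tmax) : Digraph V where
  Adj X Y := ∃ t' t : Set.Icc t₀ tmax, t' ≤ t ∧ G.Edge (X, t') (Y, t)

/-- The edge relation of a full-time DAG over finitely many variables is well-founded. -/
theorem wf [Finite V] (G : FTDAG V t₀ tmax) : WellFounded G.Edge := by
  have : IsTrans _ (Relation.TransGen G.Edge) := ⟨fun _ _ _ h h' => h.trans h'⟩
  have : Std.Irrefl (Relation.TransGen G.Edge) := ⟨G.acyclic⟩
  exact Subrelation.wf (r := Relation.TransGen G.Edge) (fun h => Relation.TransGen.single h)
    (Finite.wellFounded_of_trans_of_irrefl _)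

end FTDAG

/-- The full-time DAGs (of stationary models) that are compatible with the summary causal
graph `S`. -/
def compatible (t₀ tmax : ℤ) (S : Digraph V) : Set (FTDAG V t₀ tmax) :=
  {G | G.Stationary ∧ G.scg = S}

/-! ### Conditional independence, causal Markov condition, Markov equivalence -/

/-- The σ-algebra generated by the coordinates in `A`. -/
abbrev coordAlg (A : Set (Vtx V t₀ tmax)) : MeasurableSpace (Vtx V t₀ tmax → ℝ) :=
  MeasurableSpace.comap (fun x (v : A) => x v) MeasurableSpace.pi

theorem coordAlg_le (A : Set (Vtx V t₀ tmax)) :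
    coordAlg A ≤ (MeasurableSpace.pi : MeasurableSpace (Vtx V t₀ tmax → ℝ)) :=
  Measurable.comap_le (measurable_pi_lambda _ fun v => measurable_pi_apply (v : Vtx V t₀ tmax))

/-- Under `P`, the variables in `A` are independent of those in `B` given those in `C`. -/
def CI [Finite V] (P : Measure (Vtx V t₀ tmax → ℝ)) [IsFiniteMeasure P]
    (A B C : Set (Vtx V t₀ tmax)) : Prop :=
  CondIndep (coordAlg C) (coordAlg A) (coordAlg B) (coordAlg_le C) P

/-- Causal Markov condition: each variable is independent of its non-descendants given its
parents. -/
def FTDAG.Markov [Finite V] (G : FTDAG V t₀ tmax) (P : Measure (Vtx V t₀ tmax → ℝ))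
    [IsFiniteMeasure P] : Prop :=
  ∀ v, CI P {v} (G.nd v) (G.pa v)

/-- The conditional independence of `A` and `B` given `C` is entailed by the causal Markov
condition of `G`: it holds in every distribution satisfying that condition. -/
def FTDAG.Entails [Finite V] (G : FTDAG V t₀ tmax) (A B C : Set (Vtx V t₀ tmax)) : Prop :=
  ∀ (P : Measure (Vtx V t₀ tmax → ℝ)) [IsProbabilityMeasure P], G.Markov P → CI P A B C

/-- The Markov equivalence class of `G`: the full-time DAGs entailing the same conditional
independencies (between pairwise disjoint sets of variables). -/
def FTDAG.mec [Finite V] (G : FTDAG V t₀ tmax) : Set (FTDAG V t₀ tmax) :=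
  {H | ∀ A B C : Set (Vtx V t₀ tmax), Disjoint A B → Disjoint A C → Disjoint B C →
    (H.Entails A B C ↔ G.Entails A B C)}

/-! ### Partially directed graphs and the FT-MPDAG -/

/-- A graph on the micro-variables with directed edges `u → v` and undirected edges `u - v`. -/
structure PDAG (V : Type*) (t₀ tmax : ℤ) where
  dir : Vtx V t₀ tmax → Vtx V t₀ tmax → Prop
  undir : Vtx V t₀ tmax → Vtx V t₀ tmax → Prop

namespace PDAG

def Adj (M : PDAG V t₀ tmax) (u v : Vtx V t₀ tmax) : Prop :=
  M.dir u v ∨ M.dir v u ∨ M.undir u v ∨ M.undir v u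

def UnshieldedCollider (M : PDAG V t₀ tmax) (a c b : Vtx V t₀ tmax) : Prop :=
  M.dir a c ∧ M.dir b c ∧ a ≠ b ∧ ¬ M.Adj a b

/-- The full-time DAGs represented by a partially directed graph: same skeleton, same unshielded
colliders, and every directed edge is kept. -/
def represented (M : PDAG V t₀ tmax) : Set (FTDAG V t₀ tmax) :=
  {G | (∀ u v, G.Adj u v ↔ M.Adj u v) ∧
    (∀ a c b, G.UnshieldedCollider a c b ↔ M.UnshieldedCollider a c b) ∧
    ∀ u v, M.dir u v → G.Edge u v}

end PDAG

/-- The FT-MPDAG obtained from the Markov equivalence class of `G` with background knowledge the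
summary causal graph `S`, maximally oriented: an edge is directed if it has the same direction in
all members of the class that are compatible with `S`, and it is undirected if two such
members disagree about its direction. -/
def ftMPDAG [Finite V] (G : FTDAG V t₀ tmax) (S : Digraph V) : PDAG V t₀ tmax where
  dir u v := ∀ H ∈ G.mec ∩ compatible t₀ tmax S, H.Edge u v
  undir u v := (∃ H ∈ G.mec ∩ compatible t₀ tmax S, H.Edge u v) ∧
    ∃ H ∈ G.mec ∩ compatible t₀ tmax S, H.Edge v u

/-- The possible values of the operator `orient`. -/
inductive Orientation where
  | forward
  | backward
  | nonadjacent
  | undirected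

open Classical in
/-- The relation between `u` and `v` in a partially directed graph. -/
def PDAG.orient (M : PDAG V t₀ tmax) (u v : Vtx V t₀ tmax) : Orientation :=
  if M.dir u v then .forward
  else if M.dir v u then .backward
  else if M.undir u v then .undirected
  else .nonadjacent

/-! ### Discrete-time dynamic structural causal models -/

/-- A dynamic structural causal model `Y_t := f^{y_t}(parents of Y_t, L^{y_t})` with real-valued
observed variables. The noise terms of one series share a value space, so that mechanisms at
different times can be compared; each `Y_t` has its own noise term `L^{y_t}`, which enters no other
equation. -/
structure DSCM (V : Type*) (t₀ tmax : ℤ) where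
  graph : FTDAG V t₀ tmax
  Noise : V → Type
  noiseSpace : ∀ Y, MeasurableSpace (Noise Y)
  f : ∀ v : Vtx V t₀ tmax, (graph.pa v → ℝ) → Noise v.1 → ℝ
  measurable_f : ∀ v, Measurable fun p : (graph.pa v → ℝ) × Noise v.1 => f v p.1 p.2
  noiseLaw : Measure (∀ v : Vtx V t₀ tmax, Noise v.1)
  isProb : IsProbabilityMeasure noiseLaw

attribute [instance] DSCM.noiseSpace DSCM.isProb

namespace DSCM

/-- Causal sufficiency: the noise terms are mutually independent. (That a noise term affects
only one observed variable is part of the form of the structural equations.) -/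
def CausallySufficient (M : DSCM V t₀ tmax) : Prop :=
  iIndepFun (fun (v : Vtx V t₀ tmax) (e : ∀ v : Vtx V t₀ tmax, M.Noise v.1) => e v) M.noiseLaw

/-- Stationarity: the graph is stationary, and the mechanisms of `Y_t` and `Y_s` are the same
function of the noise and of the correspondingly lagged parents, whenever the parents of `Y_t`
and of `Y_s` correspond to each other under the time shift. -/
def Stationary (M : DSCM V t₀ tmax) : Prop :=
  M.graph.Stationary ∧
  ∀ (Y : V) (t s : Set.Icc t₀ tmax),
    (∀ u ∈ M.graph.pa (Y, t), ∃ w ∈ M.graph.pa (Y, s), w.1 = u.1 ∧ (t : ℤ) - u.2 = (s : ℤ) - w.2) →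
    (∀ w ∈ M.graph.pa (Y, s), ∃ u ∈ M.graph.pa (Y, t), u.1 = w.1 ∧ (t : ℤ) - u.2 = (s : ℤ) - w.2) →
    ∀ (p : M.graph.pa (Y, t) → ℝ) (q : M.graph.pa (Y, s) → ℝ),
      (∀ u w, u.1.1 = w.1.1 → (t : ℤ) - u.1.2 = (s : ℤ) - w.1.2 → p u = q w) →
      ∀ e : M.Noise Y, M.f (Y, t) p e = M.f (Y, s) q e

open Classical in
/-- The solution of the structural equations for the noise values `e` under the intervention
that sets each variable in `I` to its value in `a`. -/
def solve [Finite V] (M : DSCM V t₀ tmax) (I : Set (Vtx V t₀ tmax)) (a : Vtx V t₀ tmax → ℝ)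
    (e : ∀ v : Vtx V t₀ tmax, M.Noise v.1) : Vtx V t₀ tmax → ℝ :=
  M.graph.wf.fix fun v rec =>
    if v ∈ I then a v else M.f v (fun u => rec u.1 u.2) (e v)

open Classical in
theorem solve_eq [Finite V] (M : DSCM V t₀ tmax) (I : Set (Vtx V t₀ tmax))
    (a : Vtx V t₀ tmax → ℝ) (e : ∀ v : Vtx V t₀ tmax, M.Noise v.1) (v : Vtx V t₀ tmax) :
    M.solve I a e v = if v ∈ I then a v else M.f v (fun u => M.solve I a e u.1) (e v) :=
  M.graph.wf.fix_eq _ v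

theorem measurable_solve [Finite V] (M : DSCM V t₀ tmax) (I : Set (Vtx V t₀ tmax))
    (a : Vtx V t₀ tmax → ℝ) : Measurable (M.solve I a) := by
  classical
  refine measurable_pi_lambda _ fun v => ?_
  induction v using M.graph.wf.induction with
  | _ v ih =>
    simp only [solve_eq M I a _ v]
    by_cases hv : v ∈ I
    · simp only [hv, if_true]; exact measurable_const
    · simp only [hv, if_false]
      exact (M.measurable_f v).comp
        ((measurable_pi_lambda _ fun u => ih u.1 u.2).prodMk (measurable_pi_apply v))

/-- The observational distribution. -/
def obsLaw [Finite V] (M : DSCM V t₀ tmax) : Measure (Vtx V t₀ tmax → ℝ) :=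
  M.noiseLaw.map (M.solve ∅ 0)

instance [Finite V] (M : DSCM V t₀ tmax) : IsProbabilityMeasure M.obsLaw :=
  Measure.isProbabilityMeasure_map (M.measurable_solve ∅ 0).aemeasurable

/-- Faithfulness: all conditional independencies in the observational distribution are
entailed by the causal Markov condition. -/
def Faithful [Finite V] (M : DSCM V t₀ tmax) : Prop :=
  ∀ A B C : Set (Vtx V t₀ tmax), Disjoint A B → Disjoint A C → Disjoint B C →
    CI M.obsLaw A B C → M.graph.Entails A B C

/-- The distribution of `y` under `do(x), do(pa(y) \ {x})`, all intervened variables being set to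
their values in `a`. -/
def cdLaw [Finite V] (M : DSCM V t₀ tmax) (x y : Vtx V t₀ tmax) (a : Vtx V t₀ tmax → ℝ) :
    Measure ℝ :=
  M.noiseLaw.map fun e => M.solve (insert x (M.graph.pa y)) a e y

open Classical in
/-- The controlled direct effect on `y` of changing `x` from `x₀` to `x₁`, with the other parents
of `y` held at their values in `s`. -/
def cde [Finite V] (M : DSCM V t₀ tmax) (x y : Vtx V t₀ tmax) (s : Vtx V t₀ tmax → ℝ)
    (x₀ x₁ : ℝ) : ℝ :=
  (∫ r, r ∂(M.cdLaw x y (Function.update s x x₁))) -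
    ∫ r, r ∂(M.cdLaw x y (Function.update s x x₀))

end DSCM

/-! ### Identifiability -/

/-- The pair `{S_X, S_Y}` is s-identifiable from `S` and the distributions compatible with `S`:
for every causally sufficient, faithful and stationary model whose full-time DAG is compatible with
`S`, the edge between `X_t` and `Y_t` is not left undirected in the FT-MPDAG. -/
def SIdentifiable [Finite V] (t₀ tmax : ℤ) (S : Digraph V) (X Y : V) : Prop :=
  ∀ M : DSCM V t₀ tmax, M.CausallySufficient → M.Faithful → M.Stationary →
    M.graph ∈ compatible t₀ tmax S →
    ∀ t : Set.Icc t₀ tmax, (ftMPDAG M.graph S).orient (X, t) (Y, t) ≠ Orientation.undirected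

/-- The neighbours of `Y` in a summary causal graph. -/
def neighbours (Y : V) (S : Digraph V) : Set V := {X | X ≠ Y ∧ (S.Adj X Y ∨ S.Adj Y X)}

open Classical in
/-- The controlled direct effect of `x` on `y` is identifiable from `G`: any two causally
sufficient models whose full-time DAGs are represented by `G` and that have the same observational
distribution agree on the distribution of `y` under `do(x), do(pa(y) \ {x})`, and on the
controlled direct effects. As interventional distributions are conditional distributions,
the values set by the intervention range over a set of full observational probability. -/
def CDEIdentifiable [Finite V] (G : PDAG V t₀ tmax) (x y : Vtx V t₀ tmax) : Prop :=
  ∀ M₁ M₂ : DSCM V t₀ tmax, M₁.graph ∈ G.represented → M₂.graph ∈ G.represented →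
    M₁.CausallySufficient → M₂.CausallySufficient → M₁.obsLaw = M₂.obsLaw →
    ∃ A : Set (Vtx V t₀ tmax → ℝ), A ∈ ae M₁.obsLaw ∧
      (∀ a ∈ A, M₁.cdLaw x y a = M₂.cdLaw x y a) ∧
      ∀ s x₀ x₁, Function.update s x x₀ ∈ A → Function.update s x x₁ ∈ A →
        M₁.cde x y s x₀ x₁ = M₂.cde x y s x₀ x₁

end TimeSeries

end

namespace TimeSeries

variable {V : Type*} {t₀ tmax : ℤ}

namespace FTDAG

/-! An undirected edge of the FT-MPDAG at `Y_t` means that two compatible graphs orient it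
oppositely. As edges never point back in time, it is contemporaneous and joins neighbouring series
(`undir_ftMPDAG`), which s-identifiability excludes. Hence all represented graphs give `Y_t` the
same parent set `C` (`PDAG.pa_eq_of_mem_represented`). Under causal sufficiency the noise of `Y_t`
is independent of its parents, so the mechanism, seen as a kernel, disintegrates the observational
law of `(C, Y_t)` over `C` (`CausallySufficient.map_obsLaw`). Intervening on all parents returns
exactly this kernel (`cdLaw_eq_mechKernel`). Disintegrations are almost everywhere unique, so the
observational law determines the effect. -/

theorem not_edge_symm (G : FTDAG V t₀ tmax) {u v : Vtx V t₀ tmax} (h : G.Edge u v) :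
    ¬ G.Edge v u :=
  fun h' => G.acyclic u ((Relation.TransGen.single h).tail h')

theorem self_notMem_pa (G : FTDAG V t₀ tmax) (v : Vtx V t₀ tmax) : v ∉ G.pa v :=
  fun h => G.acyclic v (Relation.TransGen.single h)

theorem notMem_de_of_mem_pa (G : FTDAG V t₀ tmax) {u v : Vtx V t₀ tmax} (h : u ∈ G.pa v) :
    u ∉ G.de v :=
  fun h' => G.acyclic v (Relation.TransGen.tail' h' h)

theorem self_mem_mec [Finite V] (G : FTDAG V t₀ tmax) : G ∈ G.mec :=
  fun _ _ _ _ _ _ => Iff.rfl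

end FTDAG

/-! ### Parents in the graphs represented by an FT-MPDAG -/

/-- A node all of whose incident edges are directed has the same parents in all represented
graphs. -/
theorem PDAG.pa_eq_of_mem_represented {M : PDAG V t₀ tmax} {y : Vtx V t₀ tmax}
    (hM : ∀ u, ¬ M.undir u y ∧ ¬ M.undir y u) {H : FTDAG V t₀ tmax} (hH : H ∈ M.represented) :
    H.pa y = {u | M.dir u y} := by
  ext u
  refine ⟨fun hu => ?_, hH.2.2 u y⟩
  rcases (hH.1 u y).1 (Or.inl hu) with h | h | h | h
  · exact h
  · exact absurd hu (H.not_edge_symm (hH.2.2 y u h))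
  · exact absurd h (hM u).1
  · exact absurd h (hM u).2

/-- An undirected edge of an FT-MPDAG joins contemporaneous variables of neighbouring series, and
the operator `orient` reports it. -/
theorem undir_ftMPDAG [Finite V] {G : FTDAG V t₀ tmax} {S : Digraph V} {u v : Vtx V t₀ tmax}
    (h : (ftMPDAG G S).undir u v) :
    u.2 = v.2 ∧ u.1 ∈ neighbours v.1 S ∧ (ftMPDAG G S).orient u v = Orientation.undirected := by
  obtain ⟨⟨H, hH, huv⟩, ⟨K, hK, hvu⟩⟩ := id h
  -- `H` and `K` orient the edge oppositely, so temporal order gives both inequalities.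
  have ht : u.2 = v.2 := le_antisymm (H.temporal _ _ huv) (K.temporal _ _ hvu)
  refine ⟨ht, ⟨fun hs => ?_, Or.inl ?_⟩, ?_⟩
  · obtain rfl : u = v := Prod.ext hs ht
    exact H.self_notMem_pa u huv
  · rw [← hH.2.2]
    exact ⟨u.2, v.2, ht.le, huv⟩
  · have h₁ : ¬ (ftMPDAG G S).dir u v := fun h' => K.not_edge_symm hvu (h' K hK)
    have h₂ : ¬ (ftMPDAG G S).dir v u := fun h' => H.not_edge_symm huv (h' H hH)
    simp [PDAG.orient, h₁, h₂, h]

theorem undir_ftMPDAG_symm [Finite V] {G : FTDAG V t₀ tmax} {S : Digraph V}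
    {u v : Vtx V t₀ tmax} (h : (ftMPDAG G S).undir u v) : (ftMPDAG G S).undir v u :=
  ⟨h.2, h.1⟩

/-! ### Mechanisms as conditional distributions -/

namespace DSCM

/-- The conditional distribution of `v` given its parents that is induced by the mechanism
of `v`. -/
noncomputable def mechKernel (M : DSCM V t₀ tmax) (v : Vtx V t₀ tmax) : Kernel (M.graph.pa v → ℝ) ℝ :=
  (Kernel.id ×ₖ Kernel.const _ (M.noiseLaw.map fun e => e v)).map fun p => M.f v p.1 p.2

instance (M : DSCM V t₀ tmax) (v : Vtx V t₀ tmax) :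
    IsProbabilityMeasure (M.noiseLaw.map fun e => e v) :=
  Measure.isProbabilityMeasure_map (measurable_pi_apply v).aemeasurable

instance (M : DSCM V t₀ tmax) (v : Vtx V t₀ tmax) : IsMarkovKernel (M.mechKernel v) :=
  Kernel.IsMarkovKernel.map _ (M.measurable_f v)

theorem mechKernel_apply (M : DSCM V t₀ tmax) (v : Vtx V t₀ tmax) (p : M.graph.pa v → ℝ) :
    M.mechKernel v p = (M.noiseLaw.map fun e => e v).map (M.f v p) := by
  rw [mechKernel, Kernel.map_apply _ (M.measurable_f v), Kernel.prod_apply, Kernel.id_apply,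
    Kernel.const_apply, Measure.dirac_prod, Measure.map_map (M.measurable_f v) (by fun_prop)]
  rfl

/-- Intervening on all parents of `y` (and on `x ≠ y`) leaves the mechanism of `y`. -/
theorem cdLaw_eq_mechKernel [Finite V] (M : DSCM V t₀ tmax) {x y : Vtx V t₀ tmax} (hxy : x ≠ y)
    (a : Vtx V t₀ tmax → ℝ) : M.cdLaw x y a = M.mechKernel y fun u => a u := by
  have hy : y ∉ insert x (M.graph.pa y) := by
    rintro (h | h)
    exacts [hxy h.symm, M.graph.self_notMem_pa y h]
  have hf : Measurable (M.f y fun u => a u) := (M.measurable_f y).comp measurable_prodMk_left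
  rw [mechKernel_apply, Measure.map_map hf (measurable_pi_apply y), cdLaw]
  congr 1
  funext e
  rw [solve_eq, if_neg hy]
  simp only [Function.comp_apply]
  congr 1
  funext u
  rw [solve_eq, if_pos (Set.mem_insert_of_mem _ u.2)]

/-- The solution at a non-descendant of `y` does not depend on the noise term of `y`. -/
theorem solve_congr_of_notMem_de [Finite V] (M : DSCM V t₀ tmax) (I : Set (Vtx V t₀ tmax))
    (a : Vtx V t₀ tmax → ℝ) {e e' : ∀ v : Vtx V t₀ tmax, M.Noise v.1} {y : Vtx V t₀ tmax}
    (h : ∀ v, v ≠ y → e v = e' v) {v : Vtx V t₀ tmax} (hv : v ∉ M.graph.de y) :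
    M.solve I a e v = M.solve I a e' v := by
  induction v using M.graph.wf.induction with
  | _ v ih =>
    have hvy : v ≠ y := by
      rintro rfl
      exact hv Relation.ReflTransGen.refl
    rw [solve_eq, solve_eq, h v hvy]
    congr 2
    funext u
    exact ih u.1 u.2 fun hu => hv (Relation.ReflTransGen.tail hu u.2)

/-- Under causal sufficiency, the noise term of `y` is independent of the parents of `y`. -/
theorem CausallySufficient.indepFun_pa_noise [Finite V] {M : DSCM V t₀ tmax}
    (hM : M.CausallySufficient) (y : Vtx V t₀ tmax) :
    IndepFun (fun e (u : M.graph.pa y) => M.solve ∅ 0 e u) (fun e => e y) M.noiseLaw := by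
  classical
  have := Fintype.ofFinite V
  obtain ⟨e₀⟩ : Nonempty (∀ v : Vtx V t₀ tmax, M.Noise v.1) :=
    nonempty_of_isProbabilityMeasure M.noiseLaw
  let T : Finset (Vtx V t₀ tmax) := {y}
  have hind := hM.indepFun_finset Tᶜ T disjoint_compl_left fun v => measurable_pi_apply v
  -- The noise of `y` is filled in with the arbitrary value `e₀ y`. Parents of `y` are
  -- non-descendants of `y`, so their values do not change and are functions of the other noise
  -- terms alone.
  let ext : (∀ v : ↥(Tᶜ), M.Noise v.1.1) → ∀ v : Vtx V t₀ tmax, M.Noise v.1 :=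
    fun r v => if h : v ∈ Tᶜ then r ⟨v, h⟩ else e₀ v
  have hext : Measurable ext := measurable_pi_lambda _ fun v => by
    by_cases h : v ∈ Tᶜ
    · simpa only [ext, dif_pos h] using measurable_pi_apply (⟨v, h⟩ : ↥(Tᶜ))
    · simp only [ext, dif_neg h, measurable_const]
  have hsol : Measurable fun e (u : M.graph.pa y) => M.solve ∅ 0 e u :=
    measurable_pi_lambda _ fun u => (measurable_pi_apply u.1).comp (M.measurable_solve ∅ 0)
  have hcomp := hind.comp (hsol.comp hext)
    (measurable_pi_apply (⟨y, Finset.mem_singleton_self y⟩ : ↥T))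
  convert hcomp using 1
  swap
  · rfl
  funext e u
  refine M.solve_congr_of_notMem_de ∅ 0 (fun v hv => ?_) (M.graph.notMem_de_of_mem_pa u.2)
  simp [ext, T, hv]

/-- Under causal sufficiency, the mechanism of `y` is the conditional distribution of `y` given
its parents. -/
theorem CausallySufficient.map_obsLaw [Finite V] {M : DSCM V t₀ tmax}
    (hM : M.CausallySufficient) (y : Vtx V t₀ tmax) :
    M.obsLaw.map (fun z => ((fun u : M.graph.pa y => z u), z y)) =
      (M.obsLaw.map fun z (u : M.graph.pa y) => z u) ⊗ₘ M.mechKernel y := by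
  have hres : Measurable fun (z : Vtx V t₀ tmax → ℝ) (u : M.graph.pa y) => z u := by fun_prop
  have hsol := M.measurable_solve ∅ 0
  have hprod := (indepFun_iff_map_prod_eq_prod_map_map (hres.comp hsol).aemeasurable
    (measurable_pi_apply y).aemeasurable).1 (hM.indepFun_pa_noise y)
  have hg : Measurable fun p : (M.graph.pa y → ℝ) × M.Noise y.1 => (p.1, M.f y p.1 p.2) :=
    measurable_fst.prodMk (M.measurable_f y)
  rw [obsLaw, Measure.map_map (by fun_prop) hsol, Measure.map_map hres hsol]
  -- By independence both sides are the image of the product of the parents' law and the noise law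
  -- under `(p, l) ↦ (p, f p l)`.
  trans ((M.noiseLaw.map fun e (u : M.graph.pa y) => M.solve ∅ 0 e u).prod
    (M.noiseLaw.map fun e => e y)).map fun p => (p.1, M.f y p.1 p.2)
  · erw [← hprod]
    rw [Measure.map_map hg ((hres.comp hsol).prodMk (measurable_pi_apply y))]
    congr 1
    funext e
    refine Prod.ext rfl ?_
    simp only [Function.comp_apply]
    rw [solve_eq, if_neg (Set.notMem_empty y)]
  · have : IsProbabilityMeasure (M.noiseLaw.map fun e (u : M.graph.pa y) => M.solve ∅ 0 e u) :=
      Measure.isProbabilityMeasure_map (hres.comp hsol).aemeasurable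
    ext s hs
    rw [Measure.map_apply hg hs, Measure.prod_apply (hg hs)]
    erw [Measure.compProd_apply hs]
    refine lintegral_congr fun p => ?_
    have hf : Measurable (M.f y p) := (M.measurable_f y).comp measurable_prodMk_left
    rw [mechKernel_apply, Measure.map_apply hf (measurable_prodMk_left hs)]
    rfl

/-- The controlled direct effects on `y` are given by a version of the conditional distribution of
`y` given its parents. -/
theorem CausallySufficient.exists_kernel [Finite V] {M : DSCM V t₀ tmax}
    (hM : M.CausallySufficient) {y : Vtx V t₀ tmax} {C : Set (Vtx V t₀ tmax)}
    (hC : M.graph.pa y = C) :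
    ∃ κ : Kernel (C → ℝ) ℝ, IsMarkovKernel κ ∧
      M.obsLaw.map (fun z => ((fun u : C => z u), z y)) =
        (M.obsLaw.map fun z (u : C) => z u) ⊗ₘ κ ∧
      ∀ x a, x ≠ y → M.cdLaw x y a = κ fun u => a u := by
  -- A free index set `C` lets the kernels of two models with different graphs have the same type.
  subst hC
  exact ⟨M.mechKernel y, inferInstance, hM.map_obsLaw y, fun x a h => M.cdLaw_eq_mechKernel h a⟩

end DSCM

/-! ### Identifiability from a common parent set -/

/-- Controlled direct effects on a variable are identifiable if its parents are the same in all
represented graphs. -/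
theorem cdeIdentifiable_of_pa_eq [Finite V] {G : PDAG V t₀ tmax} {x y : Vtx V t₀ tmax}
    {C : Set (Vtx V t₀ tmax)} (hC : ∀ H ∈ G.represented, H.pa y = C) (hxy : x ≠ y) :
    CDEIdentifiable G x y := by
  intro M₁ M₂ h₁ h₂ hs₁ hs₂ hobs
  obtain ⟨κ₁, _, hj₁, hc₁⟩ := hs₁.exists_kernel (hC _ h₁)
  obtain ⟨κ₂, _, hj₂, hc₂⟩ := hs₂.exists_kernel (hC _ h₂)
  have hres : Measurable fun (z : Vtx V t₀ tmax → ℝ) (u : C) => z u := by fun_prop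
  have : IsProbabilityMeasure (M₁.obsLaw.map fun z (u : C) => z u) :=
    Measure.isProbabilityMeasure_map hres.aemeasurable
  -- Both kernels disintegrate the same law on `(C, y)`, so they agree almost everywhere for the law
  -- of the `C`-coordinates.
  have hae := Kernel.ae_eq_of_compProd_eq (hj₁.symm.trans (by rw [hobs, hj₂]))
  have hA : ∀ a ∈ {a : Vtx V t₀ tmax → ℝ | (κ₁ fun u => a u) = κ₂ fun u => a u},
      M₁.cdLaw x y a = M₂.cdLaw x y a := fun a ha => by
    rw [hc₁ x a hxy, hc₂ x a hxy]
    exact ha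
  -- The full-measure set of parent values is pulled back to full configurations.
  refine ⟨_, ae_of_ae_map hres.aemeasurable hae, hA, fun s x₀ x₁ h₀ h₁ => ?_⟩
  rw [DSCM.cde, DSCM.cde, hA _ h₀, hA _ h₁]

end TimeSeries

theorem mainTheorem3 {V : Type*} [Finite V] (t₀ tmax : ℤ) (S : Digraph V) (Y : V)
    (hS : ∀ X ∈ TimeSeries.neighbours Y S, TimeSeries.SIdentifiable t₀ tmax S X Y)
    (M : TimeSeries.DSCM V t₀ tmax)
    (hsuff : M.CausallySufficient) (hfaith : M.Faithful) (hstat : M.Stationary)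
    (hcompat : M.graph ∈ TimeSeries.compatible t₀ tmax S)
    (t : Set.Icc t₀ tmax) (x : TimeSeries.Vtx V t₀ tmax) (hxt : x.2 ≤ t) (hxy : x ≠ (Y, t)) :
    TimeSeries.CDEIdentifiable (TimeSeries.ftMPDAG M.graph S) x (Y, t) := by
  have hund : ∀ u, ¬ (TimeSeries.ftMPDAG M.graph S).undir u (Y, t) := by
    rintro ⟨X, s⟩ hu
    obtain ⟨rfl, hX, ho⟩ := TimeSeries.undir_ftMPDAG hu
    -- s-identifiability is applied to the given model itself.
    exact hS X hX M hsuff hfaith hstat hcompat _ ho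
  exact TimeSeries.cdeIdentifiable_of_pa_eq (fun H hH =>
    TimeSeries.PDAG.pa_eq_of_mem_represented
      (fun u => ⟨hund u, fun h => hund u (TimeSeries.undir_ftMPDAG_symm h)⟩) hH) hxy
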